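/- Let $\mathbb{K}$ be an algebraically closed field of characteristic $0$, let $p\in\mathbb{K}[x,y]\setminus(\mathbb{K}[x]\cup\mathbb{K}[y])$ be irreducible, and let $C\subset\mathbb{P}^1(\mathbb{K})\times\mathbb{P}^1(\mathbb{K})$ be the curve defined by the bi-homogenization $x_0^{\deg_x p}y_0^{\deg_y p}\,p(x_1/x_0,y_1/y_0)$ of $p$, where $\mathbb{P}^1(\mathbb{K})=\mathbb{K}\cup\{\infty\}$. The orbit of a point of $C$ is its equivalence class under the smallest equivalence relation $\sim$ on $C$ such that $(a,b)\sim(c,d)$ whenever $a=c$ or $b=d$. Let $r\in\mathbb{K}(x,y)$ be a rational function whose denominator (in reduced form) is not divisible by $p$. A point $(s_1,s_2)\in C$ is called a pole of $r$ if there are Möbius transformations $T_1,T_2$ of $\mathbb{P}^1(\mathbb{K})$ with $T_1(s_1)=\infty$ and $T_2(s_2)=\infty$ and a Puiseux series $\varphi$ in $x^{-1}$ over $\mathbb{K}$ such that, with $T=(T_1,T_2)$, $$\deg\varphi>0,\qquad (p\circ T^{-1})(x,\varphi)=0\qquad\text{and}\qquad \deg\,(r\circ T^{-1})(x,\varphi)>0,$$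 where $\deg$ denotes the largest exponent of $x$ occurring in a series. Let $f\in\mathbb{K}(x)$ and $g\in\mathbb{K}(y)$ be such that $f-g=r+qp$ for some $q\in\mathbb{K}(x,y)$ whose denominator is not divisible by $p$. Let $\mathcal{O}\subseteq C$ be an infinite orbit, and assume that there is an $(s_1,s_2)\in\mathcal{O}$ such that $s_1$ is a pole of $f$ or $s_2$ is a pole of $g$ (as rational functions on $\mathbb{P}^1(\mathbb{K})$, so $\infty$ is allowed). Then $\mathcal{O}$ contains a pole of $r$. -/

import Mathlib

open Polynomial

namespace SeparatedVariables

noncomputable section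

/-- The field `𝕂(x, y)` of rational functions in two variables. An element of
`Polynomial (Polynomial 𝕂)` is a polynomial in `y` whose coefficients are polynomials in `x`. -/
abbrev RatFunc₂ (K : Type*) [Field K] : Type _ := FractionRing (Polynomial (Polynomial K))

section Field

variable {K : Type*} [Field K]

/-- The numerator of a rational function in reduced form. -/
def num₂ (r : RatFunc₂ K) : Polynomial (Polynomial K) :=
  IsFractionRing.num (Polynomial (Polynomial K)) r

/-- The denominator of a rational function in reduced form. -/
def den₂ (r : RatFunc₂ K) : Polynomial (Polynomial K) :=
  (IsFractionRing.den (Polynomial (Polynomial K)) r : Polynomial (Polynomial K))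

/-- The inclusion `𝕂(x) ⊆ 𝕂(x, y)`. -/
def inX (f : RatFunc K) : RatFunc₂ K :=
  RatFunc.eval (algebraMap K (RatFunc₂ K)) (algebraMap (Polynomial (Polynomial K)) _ (C X)) f

/-- The inclusion `𝕂(y) ⊆ 𝕂(x, y)`. -/
def inY (g : RatFunc K) : RatFunc₂ K :=
  RatFunc.eval (algebraMap K (RatFunc₂ K)) (algebraMap (Polynomial (Polynomial K)) _ X) g

/-- `𝕂[x, y]_p`: the rational functions whose denominator is not divisible by `p`. -/
def localRing (p : Polynomial (Polynomial K)) : Set (RatFunc₂ K) := {h | ¬ p ∣ den₂ h}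

/-- `⟨p⟩`: the ideal of `𝕂[x, y]_p` generated by `p`. -/
def localIdeal (p : Polynomial (Polynomial K)) : Set (RatFunc₂ K) :=
  {h | ∃ q ∈ localRing p, h = q * algebraMap (Polynomial (Polynomial K)) (RatFunc₂ K) p}

/-- `F(r, p)`: the pairs `(f, g) ∈ 𝕂(x) × 𝕂(y)` with `f - g ∈ r + ⟨p⟩`. -/
def separatedPairs (r : RatFunc₂ K) (p : Polynomial (Polynomial K)) :
    Set (RatFunc K × RatFunc K) :=
  {fg | ∃ h ∈ localIdeal p, inX fg.1 - inY fg.2 = r + h}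

/-- `s ∈ 𝕂 ∪ {∞}` is a pole of the univariate rational function `f`. -/
def IsPole (f : RatFunc K) (s : OnePoint K) : Prop :=
  s.elim (f.denom.natDegree < f.num.natDegree) (fun a => f.denom.eval a = 0)

/-- The homogeneous coordinates `(x₀, x₁)` of a point of `ℙ¹(𝕂) = 𝕂 ∪ {∞}`; the affine coordinate
is `x₁ / x₀`. -/
def homCoord (s : OnePoint K) : K × K := s.elim (0, 1) (fun a => (1, a))

/-- The degree of `p` in `x`. -/
def degX (p : Polynomial (Polynomial K)) : ℕ := (Polynomial.Bivariate.swap p).natDegree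

/-- The degree of `p` in `y`. -/
def degY (p : Polynomial (Polynomial K)) : ℕ := p.natDegree

/-- The bi-homogenization `x₀ ^ deg_x p * y₀ ^ deg_y p * p(x₁ / x₀, y₁ / y₀)`, evaluated at
`u = (x₀, x₁)` and `v = (y₀, y₁)`. -/
def biHomEval (p : Polynomial (Polynomial K)) (u v : K × K) : K :=
  ∑ i ∈ Finset.range (degX p + 1), ∑ j ∈ Finset.range (degY p + 1),
    (p.coeff j).coeff i * (u.2 ^ i * u.1 ^ (degX p - i)) * (v.2 ^ j * v.1 ^ (degY p - j))

/-- The curve in `ℙ¹(𝕂) × ℙ¹(𝕂)` defined by the bi-homogenization of `p`. -/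
def curve (p : Polynomial (Polynomial K)) : Set (OnePoint K × OnePoint K) :=
  {s | biHomEval p (homCoord s.1) (homCoord s.2) = 0}

/-- The smallest equivalence relation on the curve relating any two points that share their first
or their second coordinate. -/
def orbitRel (p : Polynomial (Polynomial K)) : curve p → curve p → Prop :=
  Relation.EqvGen fun s t => s.1.1 = t.1.1 ∨ s.1.2 = t.1.2

/-- The orbit of a point on the curve. -/
def orbit (p : Polynomial (Polynomial K)) (s : curve p) : Set (curve p) := {t | orbitRel p s t}

/-- The value `r(u, v)` of a rational function at elements `u`, `v` of an extension field. -/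
def evalRat {L : Type*} [Field L] [Algebra K L] (u v : L) (r : RatFunc₂ K) : L :=
  aevalAeval u v (num₂ r) / aevalAeval u v (den₂ r)

/-- The Möbius transformation `z ↦ (a z + b) / (c z + d)` on an extension field of `𝕂`. -/
def mobius {L : Type*} [Field L] [Algebra K L] (T : GL (Fin 2) K) (z : L) : L :=
  (algebraMap K L (T 0 0) * z + algebraMap K L (T 0 1)) /
    (algebraMap K L (T 1 0) * z + algebraMap K L (T 1 1))

/-- A Hahn series with rational exponents is a Puiseux series if its exponents have a common
denominator. -/
def IsPuiseux (φ : HahnSeries ℚ K) : Prop :=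
  ∃ n : ℕ, 0 < n ∧ ∀ α ∈ φ.support, ∃ m : ℤ, α * n = m

/-- The element `x` of `𝕂{{x⁻¹}}`. Series in `𝕂{{x⁻¹}}` are written in the variable `x⁻¹`, so that
the coefficient of `x ^ α` sits at the exponent `-α`. -/
def seriesX : HahnSeries ℚ K := HahnSeries.single (-1) 1

/-- The degree in `x` of a series in `𝕂{{x⁻¹}}`, i.e. the largest `α` such that `x ^ α` occurs in
it, with the convention that the zero series has degree `-∞`. -/
def deg (φ : HahnSeries ℚ K) : WithBot ℚ :=
  open Classical in if φ = 0 then ⊥ else ((-φ.order : ℚ) : WithBot ℚ)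

open Classical in
/-- The point `s` on the curve of `p` is a pole of `r`: there is a transformation `T = (T₁, T₂)` of
`ℙ¹(𝕂) × ℙ¹(𝕂)` that maps `s` to `(∞, ∞)` and a Puiseux series `φ ∈ 𝕂{{x⁻¹}}` of positive degree
such that `(p ∘ T⁻¹)(x, φ) = 0` and `deg (r ∘ T⁻¹)(x, φ) > 0`. Here `(h ∘ T⁻¹)(x, φ)` is
`h(T₁⁻¹(x), T₂⁻¹(φ))`. -/
def IsCurvePole (p : Polynomial (Polynomial K)) (r : RatFunc₂ K) (s : curve p) : Prop :=
  ∃ T₁ T₂ : GL (Fin 2) K, T₁ • s.1.1 = OnePoint.infty ∧ T₂ • s.1.2 = OnePoint.infty ∧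
    ∃ φ : HahnSeries ℚ K, IsPuiseux φ ∧ 0 < deg φ ∧
      aevalAeval (mobius T₁⁻¹ seriesX) (mobius T₂⁻¹ φ) p = 0 ∧
      0 < deg (evalRat (mobius T₁⁻¹ seriesX) (mobius T₂⁻¹ φ) r)

end Field

end

end SeparatedVariables

/-! Suppose the orbit contains no pole of `r`. Every point `(s₁, s₂)` of the curve is the centre of
a place: with local parameter `t` at `s₁`, Newton–Puiseux gives a nonzero series `ψ` of positive
order, a local parameter at `s₂`, such that `p` vanishes at the resulting pair of coordinates
(`exists_puiseux_place`). Both coordinates are transcendental over `K`, so `f - g ∈ r + ⟨p⟩` becomes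
a true identity of series there (`sub_eq_evalRat_of_mem_separatedPairs`). As `r` is not a pole
there, `f - g` has degree at most `0`, so `f` has a pole at `s₁` exactly when `g` has one at `s₂`
(`isPole_iff_of_not_isCurvePole`).

Hence having a pole is inherited by points sharing a coordinate, and so by the whole orbit. The
orbit then lies in the finite set of pairs (pole of `f`, pole of `g`), contradicting infinitude. -/

namespace SeparatedVariables
noncomputable section

/-! ### Hensel's lemma and the Newton–Puiseux theorem -/

/-- Hensel's lemma for polynomials that need not be monic. -/
theorem exists_root_mem_of_coeff {R : Type*} [CommRing R] (I : Ideal R) [HenselianRing R I]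
    (F : R[X]) (h0 : F.coeff 0 ∈ I) (h1 : IsUnit (F.coeff 1)) : ∃ y ∈ I, F.eval y = 0 := by
  obtain ⟨u, hu⟩ := h1.exists_right_inv
  set a0 := F.coeff 0
  set a1 := F.coeff 1
  set H := F.divX.divX
  have hF : ∀ y, F.eval y = a0 + y * (a1 + y * H.eval y) := by
    intro y
    have e1 := congrArg (eval y) (divX_mul_X_add F)
    have e2 := congrArg (eval y) (divX_mul_X_add F.divX)
    simp only [eval_add, eval_mul, eval_X, eval_C, coeff_divX, zero_add] at e1 e2
    rw [← e1, ← e2]; ring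
  set d := H.natDegree
  set S : R[X] := ∑ j ∈ Finset.range (d + 1), C (H.coeff j * a0 ^ j * u ^ (j + 2)) * X ^ (d - j)
  have hS : S.degree < ((d + 1 : ℕ) : WithBot ℕ) := by
    refine (degree_sum_le _ _).trans_lt ?_
    rw [Finset.sup_lt_iff (WithBot.bot_lt_coe _)]
    intro j _
    exact (degree_C_mul_X_pow_le _ _).trans_lt (by exact_mod_cast (by omega : d - j < d + 1))
  -- Put `y = a0 * u / Z` in `F(y) = 0`, divide by `a0` and multiply by `Z ^ (d + 2)`: the result is
  -- the monic equation `G(Z) = 0`. Modulo `I` it reads `Z ^ (d + 1) * (Z + 1) = 0`, with simple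
  -- root `-1`, so monic Hensel applies.
  set G : R[X] := X ^ (d + 2) + (X ^ (d + 1) + C a0 * S)
  have hmon : G.Monic := by
    refine monic_X_pow_add ((degree_add_le _ _).trans_lt (max_lt ?_ ?_))
    · exact (degree_X_pow_le _).trans_lt (by exact_mod_cast (by omega : d + 1 < d + 2))
    · refine (degree_mul_le _ _).trans_lt ?_
      calc (C a0).degree + S.degree ≤ 0 + S.degree := by gcongr; exact degree_C_le
        _ < _ := by
          rw [zero_add]; exact hS.trans (by exact_mod_cast (by omega : d + 1 < d + 2))
  have ha0 : Ideal.Quotient.mk I a0 = 0 := Ideal.Quotient.eq_zero_iff_mem.2 h0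
  obtain ⟨Z, hZ, hZI⟩ := HenselianRing.is_henselian (I := I) G hmon (-1)
    (by
      rw [← Ideal.Quotient.eq_zero_iff_mem]
      simp only [G, eval_add, eval_mul, eval_pow, eval_X, eval_C, map_add, map_mul, map_pow, ha0,
        map_neg, map_one]
      ring)
    (by
      have : Ideal.Quotient.mk I (eval (-1) (derivative G)) = (-1) ^ (d + 1) := by
        simp only [G, derivative_mul, derivative_X_pow, derivative_C, eval_add,
          eval_mul, eval_pow, eval_X, eval_C, map_add, map_mul, map_pow, ha0, map_neg, map_one,
          zero_mul, eval_zero, map_zero, map_natCast, eval_natCast]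
        push_cast
        ring_nf
      rw [this]
      exact isUnit_one.neg.pow _)
  have hZu : IsUnit Z := by
    have := isLocalHom_of_le_jacobson_bot I HenselianRing.jac
    refine isUnit_of_map_unit (Ideal.Quotient.mk I) _ ?_
    have : Ideal.Quotient.mk I Z = -1 := by
      rw [← map_one (Ideal.Quotient.mk I), ← map_neg, Ideal.Quotient.eq]; exact hZI
    rw [this]; exact isUnit_one.neg
  obtain ⟨V, hV⟩ := hZu.exists_right_inv
  refine ⟨a0 * (u * V), I.mul_mem_right _ h0, ?_⟩
  have hSZ : S.eval Z = Z ^ d * (u ^ 2 * H.eval (a0 * (u * V))) := by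
    simp only [S, eval_finsetSum, eval_mul, eval_C, eval_pow, eval_X]
    rw [eval_eq_sum_range, Finset.mul_sum, Finset.mul_sum]
    refine Finset.sum_congr rfl fun j hj => ?_
    have : Z ^ d * V ^ j = Z ^ (d - j) := by
      have hj' : j ≤ d := by simpa [Nat.lt_succ_iff] using hj
      conv_lhs => rw [← Nat.sub_add_cancel hj', pow_add, mul_assoc, ← mul_pow, hV, one_pow, mul_one]
    rw [← this]; ring
  have hG : Z ^ d * (Z ^ 2 + Z + a0 * u ^ 2 * H.eval (a0 * (u * V))) = 0 := by
    have := hZ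
    simp only [G, IsRoot.def, eval_add, eval_mul, eval_pow, eval_X, eval_C, hSZ] at this
    rw [← this]; ring
  rw [(hZu.pow d).mul_right_eq_zero] at hG
  rw [hF]
  linear_combination a0 * V ^ 2 * hG + a0 * V * hu - a0 * (Z * V + 1 + V) * hV

section NewtonPuiseux

variable {K : Type*} [Field K]

/-- A polynomial over `K⟦X⟧` has a root of positive order in `K⟦X ^ (1 / N)⟧` for some `N`. -/
def HasPuiseuxRoot (F : (PowerSeries K)[X]) : Prop :=
  ∃ (N : ℕ) (hN : N ≠ 0) (ψ : PowerSeries K), PowerSeries.constantCoeff ψ = 0 ∧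
    F.eval₂ (PowerSeries.expand N hN : PowerSeries K →ₐ[K] PowerSeries K).toRingHom ψ = 0

/-- The residue polynomial has order exactly `m` at `0`. -/
def HasResidueOrder (F : (PowerSeries K)[X]) (m : ℕ) : Prop :=
  (∀ i < m, PowerSeries.constantCoeff (F.coeff i) = 0) ∧
    PowerSeries.constantCoeff (F.coeff m) ≠ 0

theorem eval₂_taylor {R S : Type*} [CommSemiring R] [CommSemiring S] (σ : R →+* S) (c : R)
    (F : R[X]) (y : S) : (taylor c F).eval₂ σ y = F.eval₂ σ (y + σ c) := by
  rw [eval₂_eq_eval_map, map_taylor, taylor_eval, ← eval₂_eq_eval_map]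

theorem HasPuiseuxRoot.of_taylor {F : (PowerSeries K)[X]} {c : PowerSeries K}
    (hc : PowerSeries.constantCoeff c = 0) (h : HasPuiseuxRoot (taylor c F)) :
    HasPuiseuxRoot F := by
  obtain ⟨N, hN, ψ, h0, h⟩ := h
  rw [eval₂_taylor] at h
  exact ⟨N, hN, _, by simp [h0, hc], h⟩

theorem HasResidueOrder.taylor {F : (PowerSeries K)[X]} {m : ℕ} {c : PowerSeries K}
    (hc : PowerSeries.constantCoeff c = 0) (h : HasResidueOrder F m) :
    HasResidueOrder (taylor c F) m := by
  have : ∀ i, PowerSeries.constantCoeff ((Polynomial.taylor c F).coeff i)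
      = PowerSeries.constantCoeff (F.coeff i) := by
    intro i
    rw [← coeff_map, map_taylor, hc, taylor_zero, coeff_map]
  simpa only [HasResidueOrder, this] using h

/-- In characteristic zero a translation kills the coefficient of degree `m - 1`. -/
theorem HasResidueOrder.exists_taylor_coeff_eq_zero [CharZero K] {F : (PowerSeries K)[X]} {m : ℕ}
    (h : HasResidueOrder F (m + 1)) :
    ∃ c : PowerSeries K, PowerSeries.constantCoeff c = 0 ∧ (Polynomial.taylor c F).coeff m = 0 := by
  -- The coefficient in question, as a function of `c`, is the Hasse derivative of order `m`. Its
  -- constant term is in `(X)` and its linear term is `(m + 1) * F.coeff (m + 1)`, a unit in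
  -- characteristic zero.
  obtain ⟨c, hc, hroot⟩ := exists_root_mem_of_coeff (Ideal.span {(PowerSeries.X : PowerSeries K)})
    (hasseDeriv m F)
    (by
      rw [Ideal.mem_span_singleton, PowerSeries.X_dvd_iff, hasseDeriv_coeff]
      simp [h.1 m (by omega)])
    (by
      rw [PowerSeries.isUnit_iff_constantCoeff, hasseDeriv_coeff, isUnit_iff_ne_zero, map_mul,
        map_natCast]
      refine mul_ne_zero ?_ (by rw [add_comm]; exact h.2)
      exact_mod_cast (Nat.choose_pos (by omega)).ne')
  refine ⟨c, ?_, by rw [taylor_coeff]; exact hroot⟩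
  rwa [Ideal.mem_span_singleton, PowerSeries.X_dvd_iff] at hc

/-- Scaling along an edge of the Newton polygon. -/
theorem HasPuiseuxRoot.of_scale {F G : (PowerSeries K)[X]} {a b k : ℕ} (ha : a ≠ 0) (hb : b ≠ 0)
    (e : K) (h : (F.map (PowerSeries.expand b hb : PowerSeries K →ₐ[K] PowerSeries K).toRingHom).comp
      (C (PowerSeries.X ^ a) * X) = C (PowerSeries.X ^ k) * G)
    (hG : HasPuiseuxRoot (taylor (PowerSeries.C e) G)) : HasPuiseuxRoot F := by
  obtain ⟨N, hN, ψ, h0, hψ⟩ := hG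
  rw [eval₂_taylor] at hψ
  have := congrArg (eval₂ (PowerSeries.expand N hN : PowerSeries K →ₐ[K] PowerSeries K).toRingHom
    (ψ + PowerSeries.C e)) h
  set σ := (PowerSeries.expand N hN : PowerSeries K →ₐ[K] PowerSeries K).toRingHom
  have hσe : σ (PowerSeries.C e) = PowerSeries.C e := PowerSeries.expand_C N hN e
  have hσX : σ PowerSeries.X = PowerSeries.X ^ N := PowerSeries.expand_X N hN
  rw [hσe] at hψ
  rw [eval₂_mul, hψ, mul_zero, eval₂_comp, eval₂_map] at this
  rw [eval₂_mul, eval₂_C, eval₂_X, map_pow, hσX] at this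
  -- The root `ψ + e` of `G` is scaled back by `X ^ a`, where `X` has meanwhile become `X ^ N`.
  refine ⟨N * b, mul_ne_zero hN hb, (PowerSeries.X ^ N) ^ a * (ψ + PowerSeries.C e), ?_, ?_⟩
  · simp [ha, hN]
  · have hcomp : (PowerSeries.expand (N * b) (mul_ne_zero hN hb) :
        PowerSeries K →ₐ[K] PowerSeries K).toRingHom = σ.comp
          (PowerSeries.expand b hb : PowerSeries K →ₐ[K] PowerSeries K).toRingHom :=
      RingHom.ext fun x => PowerSeries.expand_mul N hN b hb x
    rw [hcomp]
    exact this

/-- One step along the Newton polygon: `a / b` is the least value of `ord (F.coeff i) / (m - i)` for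
`i < m`. After `X ↦ X ^ b`, `Y ↦ X ^ a * Y` all terms have order at least `a * m`, with equality at
`m` and at a minimizing index `i₀ < m`; terms above `m` have strictly larger order. So the new
residue polynomial has degree `m` and is not a monomial. -/
theorem exists_scale {F : (PowerSeries K)[X]} {m : ℕ} (hF : HasResidueOrder F m)
    (hm : ∃ i < m, F.coeff i ≠ 0) :
    ∃ (a b : ℕ) (_ : a ≠ 0) (hb : b ≠ 0) (G : (PowerSeries K)[X]),
      (F.map (PowerSeries.expand b hb : PowerSeries K →ₐ[K] PowerSeries K).toRingHom).comp
        (C (PowerSeries.X ^ a) * X) = C (PowerSeries.X ^ (a * m)) * G ∧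
      (∀ i, F.coeff i = 0 → G.coeff i = 0) ∧
      PowerSeries.constantCoeff (G.coeff m) ≠ 0 ∧
      (∀ i, m < i → PowerSeries.constantCoeff (G.coeff i) = 0) ∧
      ∃ i < m, PowerSeries.constantCoeff (G.coeff i) ≠ 0 := by
  classical
  obtain ⟨i₁, hi₁, hi₁'⟩ := hm
  obtain ⟨i₀, hi₀, hmin⟩ := Finset.exists_min_image
    ((Finset.range m).filter fun i => F.coeff i ≠ 0)
    (fun i => ((F.coeff i).order.toNat : ℚ) / ((m - i : ℕ) : ℚ)) ⟨i₁, by simp [hi₁, hi₁']⟩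
  simp only [Finset.mem_filter, Finset.mem_range] at hi₀ hmin
  obtain ⟨hi₀m, hi₀0⟩ := hi₀
  have hXn0 : ∀ n : ℕ, (PowerSeries.X : PowerSeries K) ^ n ≠ 0 := fun n =>
    pow_ne_zero _ PowerSeries.X_ne_zero
  set a := (F.coeff i₀).order.toNat with ha_def
  set b := m - i₀ with hb_def
  have hb : b ≠ 0 := by omega
  have hacoe : ((a : ℕ) : ℕ∞) = (F.coeff i₀).order :=
    ENat.natCast_toNat (by rwa [Ne, PowerSeries.order_eq_top])
  have ha : a ≠ 0 := by
    intro h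
    rw [h] at hacoe
    have := PowerSeries.coeff_order hi₀0
    rw [← ha_def, h] at this
    exact this (by simpa using hF.1 i₀ hi₀m)
  have hle : ∀ i < m, F.coeff i ≠ 0 → a * (m - i) ≤ b * (F.coeff i).order.toNat := by
    intro i hi h0
    have := hmin i ⟨hi, h0⟩
    rw [div_le_div_iff₀ (by exact_mod_cast (by omega : 0 < m - i₀))
      (by exact_mod_cast (by omega : 0 < m - i))] at this
    rw [mul_comm b]
    exact_mod_cast this
  set σ := (PowerSeries.expand b hb : PowerSeries K →ₐ[K] PowerSeries K).toRingHom with hσ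
  have hσX : σ PowerSeries.X = PowerSeries.X ^ b := PowerSeries.expand_X b hb
  have hσc : ∀ f, PowerSeries.constantCoeff (σ f) = PowerSeries.constantCoeff f :=
    PowerSeries.constantCoeff_expand b hb
  have hco : ∀ i, ((F.map σ).comp (C (PowerSeries.X ^ a) * X)).coeff i =
      σ (F.coeff i) * PowerSeries.X ^ (a * i) := by
    intro i; rw [comp_C_mul_X_coeff, coeff_map, pow_mul]
  obtain ⟨G, hG⟩ : C (PowerSeries.X ^ (a * m)) ∣ (F.map σ).comp (C (PowerSeries.X ^ a) * X) := by
    rw [C_dvd_iff_dvd_coeff]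
    intro i
    rw [hco]
    rcases le_or_gt m i with h | h
    · exact dvd_mul_of_dvd_right (pow_dvd_pow _ (by gcongr)) _
    by_cases h0 : F.coeff i = 0
    · simp [h0]
    have h1 : PowerSeries.X ^ (a * (m - i)) ∣ σ (F.coeff i) := by
      refine (pow_dvd_pow _ (hle i h h0)).trans ?_
      rw [pow_mul, ← hσX, ← map_pow]
      exact map_dvd σ PowerSeries.X_pow_order_dvd
    have h2 : a * m = a * (m - i) + a * i := by rw [← mul_add]; congr 1; omega
    rw [h2, pow_add]
    exact mul_dvd_mul_right h1 _
  have hGc : ∀ i, σ (F.coeff i) * PowerSeries.X ^ (a * i) = PowerSeries.X ^ (a * m) * G.coeff i := by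
    intro i; rw [← hco, hG, coeff_C_mul]
  refine ⟨a, b, ha, hb, G, hG, ?_, ?_, ?_, i₀, hi₀m, ?_⟩
  · intro i h
    have := hGc i
    rw [h, map_zero, zero_mul] at this
    exact (mul_eq_zero.1 this.symm).resolve_left (hXn0 _)
  · have := hGc m
    rw [mul_comm] at this
    rw [← mul_left_cancel₀ (hXn0 _) this, hσc]
    exact hF.2
  · intro i hi
    have := hGc i
    have h2 : a * i = a * m + a * (i - m) := by rw [← mul_add]; congr 1; omega
    rw [h2, pow_add, mul_left_comm] at this
    rw [← mul_left_cancel₀ (hXn0 _) this]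
    have : a * (i - m) ≠ 0 := mul_ne_zero ha (by omega)
    simp [this]
  · intro h
    have h1 := hGc i₀
    have h2 : a * m = a * i₀ + b * a := by rw [mul_comm b, ← mul_add]; congr 1; omega
    rw [h2, pow_add, mul_comm (σ _), mul_assoc] at h1
    have h3 := mul_left_cancel₀ (hXn0 _) h1
    have h4 := PowerSeries.coeff_expand_mul b hb (F.coeff i₀) a
    have h5 : PowerSeries.coeff (b * a) (σ (F.coeff i₀)) = 0 := by
      rw [h3, PowerSeries.coeff_X_pow_mul']
      simpa using h
    exact PowerSeries.coeff_order hi₀0 (h4.symm.trans h5)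

/-- A polynomial of degree `m` whose coefficient of degree `m - 1` vanishes and which is not a
monomial has a root of multiplicity less than `m`. -/
theorem exists_taylor_coeff_ne_zero [IsAlgClosed K] [CharZero K] (P : K[X]) (m : ℕ)
    (hm : P.natDegree = m + 1) (h1 : P.coeff m = 0) (h2 : ∃ i < m + 1, P.coeff i ≠ 0) :
    ∃ e : K, ∃ k, 0 < k ∧ k < m + 1 ∧ (∀ i < k, (taylor e P).coeff i = 0) ∧
      (taylor e P).coeff k ≠ 0 := by
  have hP0 : P ≠ 0 := by rintro rfl; simp at hm
  obtain ⟨e, he⟩ := IsAlgClosed.exists_root P (by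
    rw [degree_eq_natDegree hP0, hm]; exact_mod_cast (by omega : m + 1 ≠ 0))
  have ht : P.comp (X + C e) = taylor e P := rfl
  have hmul := rootMultiplicity_eq_natTrailingDegree (p := P) (t := e)
  rw [ht] at hmul
  have hT0 : taylor e P ≠ 0 := by simpa using hP0
  refine ⟨e, P.rootMultiplicity e, (rootMultiplicity_pos hP0).2 he, ?_, ?_, ?_⟩
  -- Otherwise `P = l * (X - e) ^ (m + 1)`, whose coefficient of degree `m` is `-(m + 1) * e * l`.
  -- Its vanishing forces `e = 0`, making `P` a monomial.
  · by_contra! hle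
    obtain ⟨Q, hQ⟩ := (pow_dvd_pow _ hle).trans (pow_rootMultiplicity_dvd P e)
    have hQ0 : Q ≠ 0 := by rintro rfl; exact hP0 (by simpa using hQ)
    have hdeg := congrArg natDegree hQ
    rw [natDegree_mul (pow_ne_zero _ (X_sub_C_ne_zero e)) hQ0, natDegree_pow, natDegree_X_sub_C,
      hm] at hdeg
    rw [eq_C_of_natDegree_eq_zero (by omega : Q.natDegree = 0)] at hQ hQ0
    have hl : Q.coeff 0 ≠ 0 := by simpa using hQ0
    have hc : ((X - C e) ^ (m + 1)).coeff m = -e * (m + 1) := by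
      rw [sub_eq_add_neg, ← C_neg, coeff_X_add_C_pow]
      simp
    have he0 : e = 0 := by
      rw [hQ, coeff_mul_C, hc] at h1
      have : ((m : K) + 1) ≠ 0 := by exact_mod_cast Nat.succ_ne_zero m
      simpa [hl, this] using h1
    obtain ⟨i, hi, hi'⟩ := h2
    apply hi'
    rw [hQ, he0, coeff_mul_C]
    simp [coeff_X_pow, hi.ne]
  · intro i hi
    rw [hmul] at hi
    exact coeff_eq_zero_of_lt_natTrailingDegree hi
  · rw [hmul]
    exact mem_support_iff.1 (natTrailingDegree_mem_support_of_nonzero hT0)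

/-- **Newton–Puiseux**: over an algebraically closed field of characteristic zero, a polynomial
over `K⟦X⟧` whose residue vanishes to finite positive order at `0` has a Puiseux series root of
positive order. -/
theorem HasResidueOrder.hasPuiseuxRoot [IsAlgClosed K] [CharZero K] (m : ℕ) (hm : 0 < m)
    (F : (PowerSeries K)[X]) (hF : HasResidueOrder F m) : HasPuiseuxRoot F := by
  induction m using Nat.strong_induction_on generalizing F with
  | _ m ih =>
  obtain ⟨m, rfl⟩ : ∃ k, m = k + 1 := ⟨m - 1, by omega⟩
  obtain ⟨c, hc, hcoeff⟩ := hF.exists_taylor_coeff_eq_zero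
  refine HasPuiseuxRoot.of_taylor hc ?_
  replace hF := hF.taylor hc
  generalize Polynomial.taylor c F = F at hF hcoeff
  by_cases h0 : F.coeff 0 = 0
  · exact ⟨1, one_ne_zero, 0, map_zero _, by simp [eval₂_at_zero, h0]⟩
  obtain ⟨a, b, ha, hb, G, hG, hG0, hGm, hGtop, hGi⟩ :=
    exists_scale hF ⟨0, by omega, h0⟩
  set P := G.map (PowerSeries.constantCoeff (R := K))
  have hdeg : P.natDegree = m + 1 := by
    refine natDegree_eq_of_le_of_coeff_ne_zero (natDegree_le_iff_coeff_eq_zero.2 ?_) ?_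
    · intro N hN; rw [coeff_map]; exact hGtop N hN
    · rw [coeff_map]; exact hGm
  obtain ⟨e, k, hk0, hkm, hlow, hk⟩ := exists_taylor_coeff_ne_zero P m hdeg
    (by rw [coeff_map, hG0 m hcoeff, map_zero])
    (by obtain ⟨i, hi, hi'⟩ := hGi; exact ⟨i, hi, by rwa [coeff_map]⟩)
  have hco : ∀ i, PowerSeries.constantCoeff ((Polynomial.taylor (PowerSeries.C e) G).coeff i)
      = (Polynomial.taylor e P).coeff i := by
    intro i
    rw [← coeff_map, map_taylor, PowerSeries.constantCoeff_C]
  -- Moving the root `e` to the origin replaces the residue order `m + 1` by the multiplicity `k < m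
  -- + 1`, so the induction applies.
  refine HasPuiseuxRoot.of_scale ha hb e hG (ih k hkm hk0 _ ⟨?_, ?_⟩)
  · intro i hi; rw [hco]; exact hlow i hi
  · rw [hco]; exact hk

end NewtonPuiseux

/-! ### Orders of series and poles in local coordinates -/

variable {K : Type*} [Field K]

theorem algebraMap_hahnSeries (a : K) :
    algebraMap K (HahnSeries ℚ K) a = HahnSeries.C a := by
  rw [HahnSeries.algebraMap_apply']
  exact HahnSeries.ofPowerSeries_C a

theorem deg_pos_iff (φ : HahnSeries ℚ K) : 0 < deg φ ↔ φ ≠ 0 ∧ φ.order < 0 := by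
  unfold deg
  split_ifs with h
  · simp [h]
  · rw [← WithBot.coe_zero, WithBot.coe_lt_coe]
    simp [h]

theorem orderTop_algebraMap {a : K} (ha : a ≠ 0) :
    (algebraMap K (HahnSeries ℚ K) a).orderTop = 0 := by
  rw [algebraMap_hahnSeries]
  exact HahnSeries.orderTop_single ha

theorem orderTop_aeval_nonneg (q : K[X]) {τ : HahnSeries ℚ K} (hτ : 0 < τ.orderTop) :
    0 ≤ (aeval τ q).orderTop := by
  induction q using Polynomial.induction_on with
  | C a =>
    rw [aeval_C]
    by_cases ha : a = 0
    · simp [ha]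
    · rw [orderTop_algebraMap ha]
  | add p q hp hq => rw [map_add]; exact (le_min hp hq).trans HahnSeries.min_orderTop_le_orderTop_add
  | monomial n a h =>
    rw [pow_succ, ← mul_assoc, map_mul, aeval_X, HahnSeries.orderTop_mul]
    exact add_nonneg h hτ.le

theorem orderTop_aeval_eq_zero {q : K[X]} (hq : q.coeff 0 ≠ 0) {τ : HahnSeries ℚ K}
    (hτ : 0 < τ.orderTop) : (aeval τ q).orderTop = 0 := by
  rw [← divX_mul_X_add q, map_add, map_mul, aeval_X, aeval_C]
  rw [HahnSeries.orderTop_add_eq_right, orderTop_algebraMap hq]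
  rw [orderTop_algebraMap hq, HahnSeries.orderTop_mul]
  exact hτ.trans_le (le_add_of_nonneg_left (orderTop_aeval_nonneg _ hτ))

theorem ne_zero_and_order_of_orderTop {x : HahnSeries ℚ K} {n : ℚ} (h : x.orderTop = n) :
    x ≠ 0 ∧ x.order = n := by
  have hx : x ≠ 0 := by rintro rfl; simp at h
  refine ⟨hx, ?_⟩
  rw [← HahnSeries.order_eq_orderTop_of_ne_zero hx] at h
  exact_mod_cast h

theorem order_inv_eq_neg (x : HahnSeries ℚ K) : x⁻¹.order = -x.order := by
  by_cases hx : x = 0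
  · simp [hx]
  have := HahnSeries.order_mul hx (inv_ne_zero hx)
  rw [mul_inv_cancel₀ hx, HahnSeries.order_one] at this
  linarith

/-- The coordinate near `s ∈ 𝕂 ∪ {∞}` as a function of the local parameter `τ`. -/
def localCoord {L : Type*} [Field L] [Algebra K L] (s : OnePoint K) (τ : L) : L :=
  s.elim τ⁻¹ fun a => algebraMap K L a + τ

/-- The order of vanishing at `s ∈ 𝕂 ∪ {∞}`. -/
def localOrd (s : OnePoint K) (q : K[X]) : ℤ :=
  s.elim (-q.natDegree) fun a => q.rootMultiplicity a

/-- Factor out `(X - a) ^ rootMultiplicity`, or at `∞` pass to the reversed polynomial; what remains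
has nonzero constant term, hence order `0` at `τ`. The nonvanishing says that the coordinate is
transcendental over `K`. -/
theorem aeval_localCoord {q : K[X]} (hq : q ≠ 0) (s : OnePoint K) {τ : HahnSeries ℚ K}
    (hτ0 : τ ≠ 0) (hτ : 0 < τ.order) :
    aeval (localCoord s τ) q ≠ 0 ∧ (aeval (localCoord s τ) q).order = localOrd s q * τ.order := by
  have hτ' : 0 < τ.orderTop := (HahnSeries.zero_lt_orderTop_iff hτ0).2 hτ
  induction s with
  | infty =>
    let : Invertible τ⁻¹ := invertibleOfNonzero (inv_ne_zero hτ0)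
    have h := eval₂_reverse_mul_pow (algebraMap K (HahnSeries ℚ K)) τ⁻¹ q
    rw [invOf_eq_inv, inv_inv, ← aeval_def, ← aeval_def] at h
    obtain ⟨h0, h1⟩ := ne_zero_and_order_of_orderTop
      (orderTop_aeval_eq_zero (q := q.reverse) (by simpa using hq) hτ')
    have hp : τ⁻¹ ^ q.natDegree ≠ 0 := pow_ne_zero _ (inv_ne_zero hτ0)
    change aeval τ⁻¹ q ≠ 0 ∧ (aeval τ⁻¹ q).order = ((-q.natDegree : ℤ) : ℚ) * τ.order
    rw [← h]
    refine ⟨mul_ne_zero h0 hp, ?_⟩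
    rw [HahnSeries.order_mul h0 hp, h1, HahnSeries.order_pow, order_inv_eq_neg]
    simp
  | coe a =>
    change aeval (algebraMap K _ a + τ) q ≠ 0 ∧
      (aeval (algebraMap K _ a + τ) q).order = ((q.rootMultiplicity a : ℤ) : ℚ) * τ.order
    obtain ⟨g, hg, hg'⟩ := exists_eq_pow_rootMultiplicity_mul_and_not_dvd q hq a
    have hga : g.eval a ≠ 0 := fun h => hg' (dvd_iff_isRoot.2 h)
    have h2 : aeval (algebraMap K _ a + τ) g = aeval τ (taylor a g) := by
      rw [taylor_apply, aeval_comp]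
      simp [add_comm]
    obtain ⟨h0, h1⟩ := ne_zero_and_order_of_orderTop
      (orderTop_aeval_eq_zero (q := taylor a g) (by simpa using hga) hτ')
    rw [← h2] at h0 h1
    have h3 : aeval (algebraMap K _ a + τ) q = τ ^ q.rootMultiplicity a *
        aeval (algebraMap K _ a + τ) g := by
      conv_lhs => rw [hg]
      simp
    have hp : τ ^ q.rootMultiplicity a ≠ 0 := pow_ne_zero _ hτ0
    rw [h3]
    refine ⟨mul_ne_zero hp h0, ?_⟩
    rw [HahnSeries.order_mul hp h0, h1, HahnSeries.order_pow]
    simp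

theorem isPole_iff_localOrd (f : RatFunc K) (s : OnePoint K) :
    IsPole f s ↔ localOrd s f.num < localOrd s f.denom := by
  induction s with
  | infty =>
    change _ < _ ↔ (-(f.num.natDegree : ℤ)) < -(f.denom.natDegree : ℤ)
    omega
  | coe a =>
    change f.denom.eval a = 0 ↔ (f.num.rootMultiplicity a : ℤ) < f.denom.rootMultiplicity a
    rw [Nat.cast_lt]
    constructor
    · intro h
      have h1 : f.num.rootMultiplicity a = 0 := by
        refine rootMultiplicity_eq_zero fun h' => ?_
        obtain ⟨u, v, huv⟩ := f.isCoprime_num_denom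
        have := congrArg (eval a) huv
        rw [IsRoot.def] at h'
        simp [h, h'] at this
      rw [h1]
      exact (rootMultiplicity_pos f.denom_ne_zero).2 h
    · intro h
      exact (rootMultiplicity_pos f.denom_ne_zero).1 (by omega)

/-- Any `τ` of positive order detects poles, so `f` can be tested with `t` and `g` with the Puiseux
series `ψ` at the same place. -/
theorem isPole_iff_deg_pos (f : RatFunc K) (s : OnePoint K) {τ : HahnSeries ℚ K}
    (hτ0 : τ ≠ 0) (hτ : 0 < τ.order) :
    IsPole f s ↔
      0 < deg (aeval (localCoord s τ) f.num / aeval (localCoord s τ) f.denom) := by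
  by_cases hf : f = 0
  · subst hf
    rw [deg_pos_iff]
    induction s with
    | infty => simp [IsPole]
    | coe a => simp [IsPole]
  obtain ⟨hn, hn'⟩ := aeval_localCoord (RatFunc.num_ne_zero hf) s hτ0 hτ
  obtain ⟨hd, hd'⟩ := aeval_localCoord f.denom_ne_zero s hτ0 hτ
  rw [isPole_iff_localOrd, deg_pos_iff, div_eq_mul_inv,
    HahnSeries.order_mul hn (inv_ne_zero hd), order_inv_eq_neg, hn', hd', ← neg_mul, ← add_mul]
  have : aeval (localCoord s τ) f.num * (aeval (localCoord s τ) f.denom)⁻¹ ≠ 0 :=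
    mul_ne_zero hn (inv_ne_zero hd)
  rw [and_iff_right this, ← sub_eq_add_neg, mul_neg_iff]
  have h3 : ¬ τ.order < 0 := not_lt.2 hτ.le
  simp only [h3, and_false, hτ, and_true, false_or, sub_neg, Int.cast_lt]

theorem finite_isPole (f : RatFunc K) : {s : OnePoint K | IsPole f s}.Finite := by
  refine ((f.denom.rootSet_finite K).image (fun a : K => (a : OnePoint K)) |>.insert
    OnePoint.infty).subset ?_
  intro s hs
  induction s with
  | infty => exact Set.mem_insert _ _
  | coe a =>
    refine Set.mem_insert_of_mem _ ⟨a, ?_, rfl⟩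
    rw [mem_rootSet]
    exact ⟨f.denom_ne_zero, by rw [coe_aeval_eq_eval]; exact hs⟩

/-! ### Evaluating the congruence modulo `p` on the curve -/

theorem aevalAeval_eq_eval₂ {L : Type*} [Field L] [Algebra K L] (x y : L) (P : K[X][X]) :
    aevalAeval x y P = P.eval₂ (aeval x : K[X] →ₐ[K] L).toRingHom y := by
  induction P using Polynomial.induction_on with
  | C a => rw [aevalAeval_C, eval₂_C]; rfl
  | add p q hp hq => rw [map_add, eval₂_add, hp, hq]
  | monomial n a h =>
    rw [pow_succ, ← mul_assoc, map_mul, eval₂_mul, h, aevalAeval_Y, eval₂_X]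

/-- If `p` is irreducible and vanishes at `(u, v)` with `u` transcendental, then a polynomial
vanishes at `(u, v)` only if it is divisible by `p`. -/
theorem aevalAeval_ne_zero {L : Type*} [Field L] [Algebra K L] {p h : K[X][X]}
    (hp : Irreducible p) (hdeg : p.natDegree ≠ 0) {u v : L}
    (hu : ∀ q : K[X], q ≠ 0 → aeval u q ≠ 0) (huv : aevalAeval u v p = 0) (hh : ¬ p ∣ h) :
    aevalAeval u v h ≠ 0 := by
  -- By Gauss's lemma `p` stays irreducible over `K(x)`, hence is coprime to `h` there; the Bézout
  -- identity is then evaluated at `(u, v)`.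
  have hprim := hp.isPrimitive hdeg
  have hp' := (hprim.irreducible_iff_irreducible_map_fraction_map (K := FractionRing K[X])).1 hp
  have hh' : ¬ p.map (algebraMap K[X] (FractionRing K[X])) ∣ h.map (algebraMap _ _) :=
    fun H => hh (hprim.dvd_of_fraction_map_dvd_fraction_map H)
  obtain ⟨a, b, hab⟩ := (hp'.coprime_iff_not_dvd).2 hh'
  have hinj : Function.Injective (aeval u : K[X] →ₐ[K] L).toRingHom :=
    (injective_iff_map_eq_zero _).2 fun q hq => by_contra fun h0 => hu q h0 hq
  set ι : FractionRing K[X] →+* L := IsFractionRing.lift hinj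
  have hι : ι.comp (algebraMap K[X] (FractionRing K[X])) = (aeval u : K[X] →ₐ[K] L).toRingHom :=
    RingHom.ext fun x => IsFractionRing.lift_algebraMap hinj x
  have := congrArg (eval₂ ι v) hab
  rw [eval₂_add, eval₂_mul, eval₂_mul, eval₂_map, eval₂_map, hι, ← aevalAeval_eq_eval₂,
    ← aevalAeval_eq_eval₂, huv, eval₂_one] at this
  intro h0
  simp [h0] at this

theorem algebraMap_num₂_div_den₂ (r : RatFunc₂ K) :
    r = algebraMap K[X][X] (RatFunc₂ K) (num₂ r) / algebraMap K[X][X] (RatFunc₂ K) (den₂ r) := by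
  conv_lhs => rw [← IsFractionRing.mk'_num_den K[X][X] r]
  rw [IsFractionRing.mk'_eq_div]
  rfl

theorem inX_eq (f : RatFunc K) : inX f = algebraMap K[X][X] (RatFunc₂ K) (C f.num) /
    algebraMap K[X][X] (RatFunc₂ K) (C f.denom) := by
  have : ∀ q : K[X], eval₂ (algebraMap K (RatFunc₂ K)) (algebraMap K[X][X] _ (C X)) q =
      algebraMap K[X][X] (RatFunc₂ K) (C q) := by
    intro q
    conv_rhs => rw [← eval₂_C_X (p := q), hom_eval₂, hom_eval₂]
    rfl
  rw [inX, RatFunc.eval, this, this]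

theorem inY_eq (g : RatFunc K) : inY g = algebraMap K[X][X] (RatFunc₂ K) (g.num.map C) /
    algebraMap K[X][X] (RatFunc₂ K) (g.denom.map C) := by
  have : ∀ q : K[X], eval₂ (algebraMap K (RatFunc₂ K)) (algebraMap K[X][X] _ X) q =
      algebraMap K[X][X] (RatFunc₂ K) (q.map C) := by
    intro q
    rw [Polynomial.map, hom_eval₂]
    rfl
  rw [inY, RatFunc.eval, this, this]

theorem aevalAeval_map_C {L : Type*} [Field L] [Algebra K L] (x y : L) (q : K[X]) :
    aevalAeval x y (q.map C) = aeval y q := by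
  rw [aevalAeval_eq_eval₂, eval₂_map, aeval_def]
  congr 1
  ext a
  exact aeval_C x a

/-- A congruence `f - g ∈ r + ⟨p⟩` becomes an equality at every generic point of the curve. -/
theorem sub_eq_evalRat_of_mem_separatedPairs {L : Type*} [Field L] [Algebra K L] {p : K[X][X]}
    (hp : Irreducible p) (hdeg : p.natDegree ≠ 0) {r : RatFunc₂ K} (hr : r ∈ localRing p)
    {f g : RatFunc K} (hfg : (f, g) ∈ separatedPairs r p) {u v : L}
    (hu : ∀ q : K[X], q ≠ 0 → aeval u q ≠ 0) (hv : ∀ q : K[X], q ≠ 0 → aeval v q ≠ 0)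
    (huv : aevalAeval u v p = 0) :
    aeval u f.num / aeval u f.denom - aeval v g.num / aeval v g.denom = evalRat u v r := by
  obtain ⟨_, ⟨q, hq, rfl⟩, h⟩ := hfg
  have hq' := aevalAeval_ne_zero hp hdeg hu huv hq
  have hr' := aevalAeval_ne_zero hp hdeg hu huv hr
  have ne0 : ∀ {x : K[X][X]}, x ≠ 0 → algebraMap K[X][X] (RatFunc₂ K) x ≠ 0 := fun hx =>
    (map_ne_zero_iff _ (IsFractionRing.injective _ _)).2 hx
  have d0 : ∀ {x : RatFunc₂ K}, ¬ p ∣ den₂ x → den₂ x ≠ 0 := fun hx h0 => hx (h0 ▸ dvd_zero p)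
  have hf0 := ne0 (C_ne_zero.2 f.denom_ne_zero)
  have hg0 := ne0 ((Polynomial.map_ne_zero_iff C_injective).2 g.denom_ne_zero)
  have hr0 := ne0 (d0 hr)
  have hq0 := ne0 (d0 hq)
  change inX f - inY g = _ at h
  rw [inX_eq, inY_eq, algebraMap_num₂_div_den₂ r, algebraMap_num₂_div_den₂ q] at h
  -- Clearing denominators gives an identity of polynomials, which can be evaluated at `(u, v)`;
  -- there the term with `p` drops out and the denominators of `r` and `q` do not vanish.
  rw [div_sub_div _ _ hf0 hg0, div_mul_eq_mul_div, div_add_div _ _ hr0 hq0,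
    div_eq_div_iff (mul_ne_zero hf0 hg0) (mul_ne_zero hr0 hq0)] at h
  simp only [← map_mul, ← map_sub, ← map_add] at h
  have h' := congrArg (aevalAeval u v) (IsFractionRing.injective K[X][X] (RatFunc₂ K) h)
  simp only [map_mul, map_sub, map_add, huv, aevalAeval_map_C, aevalAeval_C, mul_zero,
    add_zero] at h'
  have hfu := hu _ f.denom_ne_zero
  have hgv := hv _ g.denom_ne_zero
  rw [evalRat, div_sub_div _ _ hfu hgv, div_eq_div_iff (mul_ne_zero hfu hgv) hr']
  refine mul_right_cancel₀ hq' ?_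
  linear_combination h'

/-! ### From power series roots to Puiseux series -/

/-- Hahn series with integral exponents as Hahn series in the `N`-th root of the variable. -/
def puiseuxEmb (N : ℕ) (hN : N ≠ 0) : HahnSeries ℤ K →+* HahnSeries ℚ K :=
  HahnSeries.embDomainRingHom
    ((AddMonoidHom.mulRight ((N : ℚ)⁻¹)).comp (Int.castAddHom ℚ))
    (fun a b h => by simpa [hN] using h)
    (fun a b => by
      have : (0 : ℚ) < (N : ℚ)⁻¹ := by positivity
      simp [this])

theorem isPuiseux_puiseuxEmb (N : ℕ) (hN : N ≠ 0) (x : HahnSeries ℤ K) :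
    IsPuiseux (puiseuxEmb N hN x) := by
  refine ⟨N, Nat.pos_of_ne_zero hN, fun α hα => ?_⟩
  obtain ⟨m, -, rfl⟩ := HahnSeries.support_embDomain_subset hα
  exact ⟨m, by simp [hN]⟩

theorem puiseuxEmb_single (N : ℕ) (hN : N ≠ 0) (n : ℤ) (a : K) :
    puiseuxEmb N hN (HahnSeries.single n a) = HahnSeries.single ((n : ℚ) * (N : ℚ)⁻¹) a :=
  HahnSeries.embDomain_single

theorem orderTop_puiseuxEmb_pos (N : ℕ) (hN : N ≠ 0) {x : PowerSeries K}
    (hx : PowerSeries.constantCoeff x = 0) :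
    0 < (puiseuxEmb N hN (HahnSeries.ofPowerSeries ℤ K x)).orderTop := by
  obtain ⟨y, rfl⟩ := PowerSeries.X_dvd_iff.2 hx
  rw [map_mul, map_mul, HahnSeries.ofPowerSeries_X, puiseuxEmb_single, HahnSeries.orderTop_mul,
    HahnSeries.orderTop_single one_ne_zero]
  have h1 : (0 : WithTop ℚ) < (((1 : ℤ) : ℚ) * (N : ℚ)⁻¹ : ℚ) := by
    rw [← WithTop.coe_zero, WithTop.coe_lt_coe]; push_cast; positivity
  refine h1.trans_le (le_add_of_nonneg_right ?_)
  by_contra! h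
  obtain ⟨α, hα, hα'⟩ := HahnSeries.orderTop_lt_iff_exists.1 h
  obtain ⟨m, hm, rfl⟩ := HahnSeries.support_embDomain_subset hα'
  obtain ⟨k, -, rfl⟩ := HahnSeries.support_embDomain_subset hm
  rw [← WithTop.coe_zero, WithTop.coe_lt_coe] at hα
  have : (0 : ℚ) ≤ (k : ℚ) * (N : ℚ)⁻¹ := by positivity
  exact absurd hα (not_lt.2 (by simpa using this))

/-- Newton–Puiseux for polynomials in two variables. -/
theorem exists_puiseux_root [IsAlgClosed K] [CharZero K] (P : K[X][X])
    (h0 : (P.coeff 0).eval 0 = 0) (h1 : P.map (evalRingHom 0) ≠ 0) :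
    ∃ ψ : HahnSeries ℚ K, IsPuiseux ψ⁻¹ ∧ 0 < ψ.orderTop ∧
      aevalAeval (HahnSeries.single 1 1) ψ P = 0 := by
  set F : (PowerSeries K)[X] := P.map coeToPowerSeries.ringHom
  have hF : ∀ i, PowerSeries.constantCoeff (F.coeff i) = (P.map (evalRingHom 0)).coeff i := by
    intro i
    rw [coeff_map, coeff_map, coeToPowerSeries.ringHom_apply, coe_evalRingHom,
      ← coeff_zero_eq_eval_zero, ← PowerSeries.coeff_zero_eq_constantCoeff_apply,
      Polynomial.coeff_coe]
  have hm : 0 < (P.map (evalRingHom 0)).natTrailingDegree := by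
    refine Nat.pos_of_ne_zero fun h => ?_
    have := natTrailingDegree_mem_support_of_nonzero h1
    rw [h, mem_support_iff, coeff_map] at this
    exact this h0
  have hres : HasResidueOrder F (P.map (evalRingHom 0)).natTrailingDegree := by
    refine ⟨fun i hi => ?_, ?_⟩
    · rw [hF]; exact coeff_eq_zero_of_lt_natTrailingDegree hi
    · rw [hF]; exact mem_support_iff.1 (natTrailingDegree_mem_support_of_nonzero h1)
  obtain ⟨N, hN, ψ, hψ0, hψ⟩ := hres.hasPuiseuxRoot _ hm
  set E : PowerSeries K →+* HahnSeries ℚ K := (puiseuxEmb N hN).comp (HahnSeries.ofPowerSeries ℤ K)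
  -- Expanding by `N` and then reading the variable as its own `N`-th root cancel, so `X` goes to
  -- the series of exponent `1`.
  have hE : (E.comp (PowerSeries.expand N hN : PowerSeries K →ₐ[K] PowerSeries K).toRingHom).comp
      coeToPowerSeries.ringHom =
        (aeval (HahnSeries.single (1 : ℚ) (1 : K)) : K[X] →ₐ[K] HahnSeries ℚ K).toRingHom := by
    refine Polynomial.ringHom_ext (fun a => ?_) ?_
    · have e1 : PowerSeries.expand N hN (PowerSeries.C a) = PowerSeries.C a :=
        PowerSeries.expand_C N hN a
      simp [E, e1, algebraMap_hahnSeries, puiseuxEmb_single]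
    · simp [E, puiseuxEmb_single, hN]
  refine ⟨E ψ, ?_, orderTop_puiseuxEmb_pos N hN hψ0, ?_⟩
  · have : (E ψ)⁻¹ = puiseuxEmb N hN (HahnSeries.ofPowerSeries ℤ K ψ)⁻¹ := 
      (map_inv₀ (puiseuxEmb (K := K) N hN) (HahnSeries.ofPowerSeries ℤ K ψ)).symm
    rw [this]
    exact isPuiseux_puiseuxEmb N hN _
  · have := congrArg E hψ
    rw [map_zero, hom_eval₂, eval₂_map, hE] at this
    rw [aevalAeval_eq_eval₂, this]

/-! ### The curve in local coordinates -/

theorem coeff_coeff_swap (p : K[X][X]) (i j : ℕ) :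
    ((Bivariate.swap p).coeff i).coeff j = (p.coeff j).coeff i := by
  induction p using Polynomial.induction_on' with
  | add p q hp hq => simp only [map_add, coeff_add, hp, hq]
  | monomial n a =>
    induction a using Polynomial.induction_on' with
    | add a b ha hb => simp only [map_add, coeff_add, ha, hb]
    | monomial m c =>
      rw [Bivariate.swap_monomial_monomial]
      simp only [coeff_monomial]
      split_ifs <;> simp_all [coeff_monomial]

theorem natDegree_coeff_le_degX (p : K[X][X]) (j : ℕ) : (p.coeff j).natDegree ≤ degX p := by
  refine natDegree_le_iff_coeff_eq_zero.2 fun i hi => ?_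
  rw [← coeff_coeff_swap, coeff_eq_zero_of_natDegree_lt hi, coeff_zero]

/-- The homogeneous coordinates near `s`, as polynomials in the local parameter. -/
def homLocalCoord (s : OnePoint K) : K[X] × K[X] := s.elim (X, 1) fun a => (1, C a + X)

theorem eval_zero_homLocalCoord (s : OnePoint K) :
    ((homLocalCoord s).1.eval 0, (homLocalCoord s).2.eval 0) = homCoord s := by
  induction s with
  | infty => simp [homLocalCoord, homCoord]
  | coe a => simp [homLocalCoord, homCoord]

theorem aeval_homLocalCoord {L : Type*} [Field L] [Algebra K L] (s : OnePoint K) {τ : L}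
    (hτ : τ ≠ 0) : aeval τ (homLocalCoord s).1 ≠ 0 ∧
      aeval τ (homLocalCoord s).2 = localCoord s τ * aeval τ (homLocalCoord s).1 := by
  induction s with
  | infty => simp [homLocalCoord, localCoord, hτ]
  | coe a => simp [homLocalCoord, localCoord]

theorem sum_homLocalCoord_ne_zero (s : OnePoint K) (c : ℕ → K) (n : ℕ)
    (hc : ∃ j ∈ Finset.range (n + 1), c j ≠ 0) :
    ∑ j ∈ Finset.range (n + 1),
      C (c j) * ((homLocalCoord s).2 ^ j * (homLocalCoord s).1 ^ (n - j)) ≠ 0 := by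
  obtain ⟨k, hk, hck⟩ := hc
  intro h
  apply hck
  rw [Finset.mem_range] at hk
  induction s with
  | infty =>
    have := congrArg (fun q => coeff q (n - k)) h
    simp only [homLocalCoord, OnePoint.elim_infty, one_pow, one_mul, finsetSum_coeff,
      coeff_C_mul_X_pow, coeff_zero] at this
    rw [Finset.sum_eq_single k] at this
    · simpa using this
    · intro j hj hjk
      rw [Finset.mem_range] at hj
      rw [if_neg (by omega)]
    · simp; omega
  | coe a =>
    have := congrArg (fun q => coeff (q.comp (X - C a)) k) h
    simp only [homLocalCoord, OnePoint.elim_some, one_pow, mul_one, Polynomial.sum_comp, mul_comp,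
      pow_comp, add_comp, C_comp, X_comp, add_sub_cancel, finsetSum_coeff,
      coeff_C_mul_X_pow, zero_comp, coeff_zero] at this
    rw [Finset.sum_eq_single k] at this
    · simpa using this
    · intro j hj hjk
      rw [if_neg (Ne.symm hjk)]
    · simp; omega

/-- The curve of `p` contains no line `{s} × ℙ¹`. -/
theorem exists_sum_homCoord_ne_zero {p : K[X][X]} (hp : Irreducible p)
    (hpx : ∀ a : K[X], p ≠ C a) (s : OnePoint K) :
    ∃ j ∈ Finset.range (degY p + 1), ∑ i ∈ Finset.range (degX p + 1),
      (p.coeff j).coeff i * ((homCoord s).2 ^ i * (homCoord s).1 ^ (degX p - i)) ≠ 0 := by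
  induction s with
  | infty =>
    have hs : Bivariate.swap p ≠ 0 := by simpa using hp.ne_zero
    have h1 : (Bivariate.swap p).coeff (degX p) ≠ 0 := leadingCoeff_ne_zero.2 hs
    obtain ⟨j, hj⟩ : ∃ j, ((Bivariate.swap p).coeff (degX p)).coeff j ≠ 0 := by
      by_contra! h
      exact h1 (Polynomial.ext fun j => by rw [h j, coeff_zero])
    rw [coeff_coeff_swap] at hj
    refine ⟨j, ?_, ?_⟩
    · rw [Finset.mem_range, Nat.lt_succ_iff]
      refine le_natDegree_of_ne_zero fun h => hj ?_
      rw [h, coeff_zero]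
    · rw [Finset.sum_eq_single (degX p)]
      · simpa [homCoord] using hj
      · intro i hi hi'
        rw [Finset.mem_range] at hi
        have : degX p - i ≠ 0 := by omega
        simp [homCoord, this]
      · simp
  | coe a =>
    by_contra! h
    have hev : ∀ j, (p.coeff j).eval a = 0 := by
      intro j
      by_cases hj : j ∈ Finset.range (degY p + 1)
      · rw [← h j hj, eval_eq_sum_range' (Nat.lt_succ_of_le (natDegree_coeff_le_degX p j))]
        simp [homCoord]
      · rw [Finset.mem_range, Nat.lt_succ_iff, not_le] at hj
        rw [coeff_eq_zero_of_natDegree_lt hj, eval_zero]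
    obtain ⟨Q, hQ⟩ : C (X - C a) ∣ p := by
      rw [C_dvd_iff_dvd_coeff]
      exact fun j => dvd_iff_isRoot.2 (hev j)
    rcases hp.isUnit_or_isUnit hQ with hu | hu
    · exact not_isUnit_X_sub_C a (isUnit_C.1 hu)
    -- A unit cofactor is constant in `y`, which would put `p` in `K[x]`.
    · obtain ⟨q, -, rfl⟩ := isUnit_iff.1 hu
      exact hpx _ (hQ.trans C_mul.symm)

/-- The bi-homogenization of `p` in local coordinates near the point `(s₁, s₂)`. -/
def localPoly (p : K[X][X]) (s₁ s₂ : OnePoint K) : K[X][X] :=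
  ∑ i ∈ Finset.range (degX p + 1), ∑ j ∈ Finset.range (degY p + 1),
    C (C ((p.coeff j).coeff i) * ((homLocalCoord s₁).2 ^ i * (homLocalCoord s₁).1 ^ (degX p - i))) *
      (((homLocalCoord s₂).2 ^ j * (homLocalCoord s₂).1 ^ (degY p - j)).map C)

theorem aevalAeval_localPoly {L : Type*} [Field L] [Algebra K L] (p : K[X][X])
    (s₁ s₂ : OnePoint K) (x y : L) :
    aevalAeval x y (localPoly p s₁ s₂) =
      ∑ i ∈ Finset.range (degX p + 1), ∑ j ∈ Finset.range (degY p + 1),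
        algebraMap K L ((p.coeff j).coeff i) *
          (aeval x (homLocalCoord s₁).2 ^ i * aeval x (homLocalCoord s₁).1 ^ (degX p - i)) *
          (aeval y (homLocalCoord s₂).2 ^ j * aeval y (homLocalCoord s₂).1 ^ (degY p - j)) := by
  simp only [localPoly, map_sum, map_mul (aevalAeval x y), aevalAeval_C, aevalAeval_map_C]
  simp only [map_mul, map_pow, aeval_C]

theorem aevalAeval_eq_sum {L : Type*} [Field L] [Algebra K L] (p : K[X][X]) (x y : L) :
    aevalAeval x y p = ∑ i ∈ Finset.range (degX p + 1), ∑ j ∈ Finset.range (degY p + 1),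
        algebraMap K L ((p.coeff j).coeff i) * x ^ i * y ^ j := by
  rw [aevalAeval_eq_eval₂, eval₂_eq_sum_range, Finset.sum_comm]
  refine Finset.sum_congr rfl fun j _ => ?_
  rw [← Finset.sum_mul]
  congr 1
  change aeval x (p.coeff j) = _
  rw [aeval_eq_sum_range' (Nat.lt_succ_of_le (natDegree_coeff_le_degX p j))]
  simp only [Algebra.smul_def]

theorem aevalAeval_localPoly_eq_mul {L : Type*} [Field L] [Algebra K L] (p : K[X][X])
    (s₁ s₂ : OnePoint K) {x y : L} (hx : x ≠ 0) (hy : y ≠ 0) :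
    aevalAeval x y (localPoly p s₁ s₂) =
      aeval x (homLocalCoord s₁).1 ^ degX p * aeval y (homLocalCoord s₂).1 ^ degY p *
        aevalAeval (localCoord s₁ x) (localCoord s₂ y) p := by
  rw [aevalAeval_localPoly, aevalAeval_eq_sum, Finset.mul_sum]
  refine Finset.sum_congr rfl fun i hi => ?_
  rw [Finset.mul_sum]
  refine Finset.sum_congr rfl fun j hj => ?_
  rw [Finset.mem_range, Nat.lt_succ_iff] at hi hj
  rw [(aeval_homLocalCoord s₁ hx).2, (aeval_homLocalCoord s₂ hy).2]
  rw [← pow_mul_pow_sub _ hi, ← pow_mul_pow_sub _ hj]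
  ring

theorem eval_coeff_zero_localPoly {p : K[X][X]} (s : curve p) :
    ((localPoly p s.1.1 s.1.2).coeff 0).eval 0 = 0 := by
  have h1 : aevalAeval (0 : K) 0 (localPoly p s.1.1 s.1.2) =
      ((localPoly p s.1.1 s.1.2).coeff 0).eval 0 := by
    rw [aevalAeval_eq_eval₂, eval₂_at_zero]
    exact congrFun (coe_aeval_eq_eval 0) _
  rw [← h1, aevalAeval_localPoly]
  have hs : biHomEval p (homCoord s.1.1) (homCoord s.1.2) = 0 := s.2
  rw [← eval_zero_homLocalCoord, ← eval_zero_homLocalCoord] at hs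
  exact hs

/-- Absence of the line `{s₁} × ℙ¹` in local form: the residue polynomial is nonzero, as
Newton–Puiseux requires. -/
theorem map_localPoly_ne_zero {p : K[X][X]} (hp : Irreducible p)
    (hpx : ∀ a : K[X], p ≠ C a) (s₁ s₂ : OnePoint K) :
    (localPoly p s₁ s₂).map (evalRingHom 0) ≠ 0 := by
  have := sum_homLocalCoord_ne_zero s₂ _ _ (exists_sum_homCoord_ne_zero hp hpx s₁)
  convert this using 1
  have hC : (evalRingHom (0 : K)).comp C = RingHom.id K := by ext; simp
  rw [localPoly, Finset.sum_comm, Polynomial.map_sum]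
  refine Finset.sum_congr rfl fun j _ => ?_
  rw [Polynomial.map_sum, map_sum, Finset.sum_mul]
  refine Finset.sum_congr rfl fun i _ => ?_
  rw [Polynomial.map_mul, map_C, Polynomial.map_map, hC, Polynomial.map_id,
    ← eval_zero_homLocalCoord]
  simp

/-- By swapping the variables, the curve contains no line `ℙ¹ × {s₂}` either. This excludes the root
`ψ = 0`, which could not serve as a local parameter. -/
theorem aevalAeval_localPoly_zero_ne_zero {p : K[X][X]} (hp : Irreducible p)
    (hpy : ∀ b : K[X], p ≠ b.map C) (s₁ s₂ : OnePoint K) {τ : HahnSeries ℚ K} (hτ0 : τ ≠ 0)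
    (hτ : 0 < τ.order) : aevalAeval τ 0 (localPoly p s₁ s₂) ≠ 0 := by
  have hswap : Irreducible (Bivariate.swap p) := (MulEquiv.irreducible_iff Bivariate.swap).2 hp
  have hsx : ∀ a : K[X], Bivariate.swap p ≠ C a := fun a h => hpy a (by
    rw [← Bivariate.swap_C, ← h, Bivariate.swap_swap_apply])
  have hne := sum_homLocalCoord_ne_zero s₁ _ _ (exists_sum_homCoord_ne_zero hswap hsx s₂)
  have := (aeval_localCoord hne (0 : K) hτ0 hτ).1
  convert this using 1
  rw [aevalAeval_localPoly]
  have h0 : localCoord ((0 : K) : OnePoint K) τ = τ := by simp [localCoord]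
  have hX : degX (Bivariate.swap p) = degY p := by
    rw [degX, Bivariate.swap_swap_apply, degY]
  have hY : degY (Bivariate.swap p) = degX p := rfl
  rw [h0, hX, hY, map_sum]
  refine Finset.sum_congr rfl fun i _ => ?_
  rw [map_mul, aeval_C, map_sum, Finset.sum_mul, map_mul, map_pow, map_pow]
  refine Finset.sum_congr rfl fun j _ => ?_
  rw [coeff_coeff_swap, ← eval_zero_homLocalCoord]
  have he : ∀ q : K[X], aeval (0 : HahnSeries ℚ K) q = algebraMap K _ (q.eval 0) := by
    intro q
    rw [← coeff_zero_eq_eval_zero, aeval_def, eval₂_at_zero]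
  simp only [he, map_mul, map_pow]
  ring

/-! ### Places on the curve and comparison of poles -/

/-- Every point of the curve is the centre of a place given by a Puiseux series. -/
theorem exists_puiseux_place [IsAlgClosed K] [CharZero K] {p : K[X][X]} (hp : Irreducible p)
    (hpx : ∀ a : K[X], p ≠ C a) (hpy : ∀ b : K[X], p ≠ b.map C) (s : curve p) :
    ∃ ψ : HahnSeries ℚ K, IsPuiseux ψ⁻¹ ∧ ψ ≠ 0 ∧ 0 < ψ.order ∧
      aevalAeval (localCoord s.1.1 (HahnSeries.single 1 1)) (localCoord s.1.2 ψ) p = 0 := by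
  obtain ⟨ψ, hψ, hpos, h⟩ := exists_puiseux_root _ (eval_coeff_zero_localPoly s)
    (map_localPoly_ne_zero hp hpx s.1.1 s.1.2)
  have hx0 : (HahnSeries.single (1 : ℚ) (1 : K)) ≠ 0 := HahnSeries.single_ne_zero one_ne_zero
  have hx : 0 < (HahnSeries.single (1 : ℚ) (1 : K)).order := by
    rw [HahnSeries.order_single one_ne_zero]; exact one_pos
  have hψ0 : ψ ≠ 0 := by
    rintro rfl
    exact aevalAeval_localPoly_zero_ne_zero hp hpy _ _ hx0 hx h
  refine ⟨ψ, hψ, hψ0, (HahnSeries.zero_lt_orderTop_iff hψ0).1 hpos, ?_⟩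
  rw [aevalAeval_localPoly_eq_mul _ _ _ hx0 hψ0] at h
  exact (mul_eq_zero.1 h).resolve_left (mul_ne_zero
    (pow_ne_zero _ (aeval_homLocalCoord _ hx0).1) (pow_ne_zero _ (aeval_homLocalCoord _ hψ0).1))

-- Translates local parameters into the Möbius form of `IsCurvePole`: for finite `a`, `T⁻¹` is `z ↦
-- a + 1 / z`, so `z` is the inverse of the local parameter.
open Classical in
theorem exists_mobius_eq_localCoord (s : OnePoint K) :
    ∃ T : GL (Fin 2) K, T • s = OnePoint.infty ∧
      ∀ z : HahnSeries ℚ K, z ≠ 0 → mobius T⁻¹ z = localCoord s z⁻¹ := by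
  induction s with
  | infty => exact ⟨1, one_smul _ _, fun z _ => by simp [mobius, localCoord]⟩
  | coe a =>
    refine ⟨(Matrix.GeneralLinearGroup.mkOfDetNeZero !![a, 1; 1, 0] (by simp))⁻¹, ?_, ?_⟩
    · rw [inv_smul_eq_iff, OnePoint.smul_infty_eq_ite]
      simp [Matrix.GeneralLinearGroup.mkOfDetNeZero]
    · intro z hz
      rw [inv_inv]
      simp [mobius, localCoord, Matrix.GeneralLinearGroup.mkOfDetNeZero]
      field_simp

theorem not_deg_pos_iff (φ : HahnSeries ℚ K) : ¬ 0 < deg φ ↔ 0 ≤ φ.orderTop := by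
  rw [deg_pos_iff]
  by_cases h : φ = 0
  · simp [h]
  · rw [← HahnSeries.order_eq_orderTop_of_ne_zero h, ← WithTop.coe_zero, WithTop.coe_le_coe]
    simp [h]

/-- The series of degree at most `0` form an additive group. -/
theorem deg_pos_iff_of_not_deg_sub_pos {x y : HahnSeries ℚ K} (h : ¬ 0 < deg (x - y)) :
    0 < deg x ↔ 0 < deg y := by
  rw [← not_iff_not, not_deg_pos_iff, not_deg_pos_iff]
  rw [not_deg_pos_iff] at h
  constructor
  · intro hx
    rw [← sub_sub_cancel x y, sub_eq_add_neg]
    exact (le_min hx (by rwa [HahnSeries.orderTop_neg])).trans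
      HahnSeries.min_orderTop_le_orderTop_add
  · intro hy
    rw [← sub_add_cancel x y]
    exact (le_min h hy).trans HahnSeries.min_orderTop_le_orderTop_add

theorem isPole_iff_of_not_isCurvePole [IsAlgClosed K] [CharZero K] {p : K[X][X]}
    (hp : Irreducible p) (hpx : ∀ a : K[X], p ≠ C a) (hpy : ∀ b : K[X], p ≠ b.map C)
    {r : RatFunc₂ K} (hr : r ∈ localRing p) {f g : RatFunc K}
    (hfg : (f, g) ∈ separatedPairs r p) {s : curve p} (hs : ¬ IsCurvePole p r s) :
    IsPole f s.1.1 ↔ IsPole g s.1.2 := by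
  obtain ⟨ψ, hψ, hψ0, hpos, h⟩ := exists_puiseux_place hp hpx hpy s
  obtain ⟨T₁, hT₁, hm₁⟩ := exists_mobius_eq_localCoord s.1.1
  obtain ⟨T₂, hT₂, hm₂⟩ := exists_mobius_eq_localCoord s.1.2
  have hx0 : (HahnSeries.single (1 : ℚ) (1 : K)) ≠ 0 := HahnSeries.single_ne_zero one_ne_zero
  have hx : 0 < (HahnSeries.single (1 : ℚ) (1 : K)).order := by
    rw [HahnSeries.order_single one_ne_zero]; exact one_pos
  have e₁ : mobius T₁⁻¹ (seriesX : HahnSeries ℚ K) = localCoord s.1.1 (HahnSeries.single 1 1) := by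
    rw [seriesX, hm₁ _ (HahnSeries.single_ne_zero one_ne_zero)]
    congr 1
    rw [HahnSeries.inv_single, inv_one, neg_neg]
  have e₂ : mobius T₂⁻¹ ψ⁻¹ = localCoord s.1.2 ψ := by
    rw [hm₂ _ (inv_ne_zero hψ0), inv_inv]
  have hdeg : p.natDegree ≠ 0 := fun h0 => hpx _ (eq_C_of_natDegree_eq_zero h0)
  have key := sub_eq_evalRat_of_mem_separatedPairs hp hdeg hr hfg
    (fun q hq => (aeval_localCoord hq s.1.1 hx0 hx).1)
    (fun q hq => (aeval_localCoord hq s.1.2 hψ0 hpos).1) h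
  have hrle : ¬ 0 < deg (evalRat (localCoord s.1.1 (HahnSeries.single 1 1))
      (localCoord s.1.2 ψ) r) := by
    intro hlt
    refine hs ⟨T₁, T₂, hT₁, hT₂, ψ⁻¹, hψ, ?_, ?_, ?_⟩
    · rw [deg_pos_iff, order_inv_eq_neg]
      exact ⟨inv_ne_zero hψ0, by linarith⟩
    · rw [e₁, e₂]; exact h
    · rw [e₁, e₂]; exact hlt
  rw [isPole_iff_deg_pos f s.1.1 hx0 hx, isPole_iff_deg_pos g s.1.2 hψ0 hpos]
  rw [← key] at hrle
  exact deg_pos_iff_of_not_deg_sub_pos hrle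

end
end SeparatedVariables

/-! ### Propagation of poles along the orbit -/

open SeparatedVariables in
theorem mainTheorem5 {K : Type*} [Field K] [IsAlgClosed K] [CharZero K]
    (p : Polynomial (Polynomial K)) (hp : Irreducible p)
    (hpx : ∀ a : Polynomial K, p ≠ Polynomial.C a)
    (hpy : ∀ b : Polynomial K, p ≠ b.map Polynomial.C)
    (r : SeparatedVariables.RatFunc₂ K) (hr : r ∈ SeparatedVariables.localRing p)
    (f g : RatFunc K) (hfg : (f, g) ∈ SeparatedVariables.separatedPairs r p)
    (s : SeparatedVariables.curve p) (hinf : (SeparatedVariables.orbit p s).Infinite)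
    (hpole : ∃ t ∈ SeparatedVariables.orbit p s,
      SeparatedVariables.IsPole f t.1.1 ∨ SeparatedVariables.IsPole g t.1.2) :
    ∃ t ∈ SeparatedVariables.orbit p s, SeparatedVariables.IsCurvePole p r t := by
  by_contra! hno
  have hiff : ∀ t ∈ orbit p s, (IsPole f t.1.1 ↔ IsPole g t.1.2) := fun t ht =>
    isPole_iff_of_not_isCurvePole hp hpx hpy hr hfg (hno t ht)
  -- Membership in the orbit of `s` is carried through the induction because the equivalence `hiff`
  -- is known only there.
  have hprop : ∀ t t', orbitRel p t t' → orbitRel p s t →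
      (IsPole f t.1.1 ↔ IsPole f t'.1.1) := by
    intro t t' h
    induction h with
    | rel x y hxy =>
      intro hx
      have hy : orbitRel p s y := hx.trans _ _ _ (.rel _ _ hxy)
      rcases hxy with h | h
      · rw [h]
      · rw [hiff x hx, hiff y hy, h]
    | refl x => exact fun _ => Iff.rfl
    | symm x y hxy ih => exact fun hy => (ih (hy.trans _ _ _ (hxy.symm _ _))).symm
    | trans x y z hxy _ ih₁ ih₂ => exact fun hx => (ih₁ hx).trans (ih₂ (hx.trans _ _ _ hxy))
  obtain ⟨t₀, ht₀, hpole⟩ := hpole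
  have hf₀ : IsPole f t₀.1.1 := hpole.elim id (hiff t₀ ht₀).2
  have hall : ∀ t ∈ orbit p s, IsPole f t.1.1 := fun t ht =>
    (hprop t₀ t ((ht₀.symm _ _).trans _ _ _ ht) ht₀).1 hf₀
  refine hinf (Set.Finite.subset (((finite_isPole f).prod (finite_isPole g)).preimage
    Subtype.val_injective.injOn) fun t ht => ?_)
  exact ⟨hall t ht, (hiff t ht).1 (hall t ht)⟩
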